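/- Let $r\ge 4$ be real and let $p,f$ be integers with $0\le f<p$. A $p$-processor contract schedule $X$ consists, for each processor $j\in\{0,\dots,p-1\}$, of a sequence of positive reals $x_{0,j}<x_{1,j}<x_{2,j}<\cdots$ (contract lengths). Processor $j$ executes these contracts consecutively from time $0$, so contract $i$ on processor $j$ completes at time $\sum_{k\le i}x_{k,j}$. If exactly the processors in a nonempty set $S$ function, the acceleration ratio $\mathrm{acc}_S(X)\in(0,\infty]$ is the supremum of $T/\ell_S(X,T)$ over all interruption times $T$ by which at least one contract has completed on a processor of $S$, where $\ell_S(X,T)$ is the length of the longest contract completed by time $T$ on a processor of $S$. The acceleration ratio of $X$ if up to $f$ processors are faulty is $$\mathrm{acc}^{(f)}(X)=\sup_{|F|\le f}\mathrm{acc}_{\{0,\dots,p-1\}\setminus F}(X),$$ and $X$ is called $r$-robust if $\mathrm{acc}_{\{j\}}(X)\le r$ for every processor $j$ (i.e. the acceleration ratio is at most $r$ if all but a single processor are faulty). The problem $\mathtt{RFT}(r,p,f)$ asks to minimize $\mathrm{acc}^{(f)}(X)$ over all $r$-robust $p$-processor schedules $X$. Let $\zeta_{1,r}=\frac{r-\sqrt{r^2-4r}}2$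 and $\zeta_{2,r}=\frac{r+\sqrt{r^2-4r}}2$ be the smallest and largest roots of $\frac{x^2}{x-1}-r$. **Theorem.** The minimum of $\mathrm{acc}^{(f)}(X)$ over all $r$-robust $p$-processor schedules $X$ exists and equals $$\min\Big\{\frac{b^{p+f+1}}{b^p-1}\;:\; b\in\big[\zeta_{1,r}^{1/p},\,\zeta_{2,r}^{1/p}\big]\Big\}$$ (the latter minimum also exists). Moreover, for every $b$ in this interval attaining the latter minimum one has $b>1$, and the cyclic schedule in which processor $j$ executes contracts of lengths $b^{j},b^{j+p},b^{j+2p},\dots$ is $r$-robust and attains the optimal acceleration ratio. -/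

import Mathlib

/-- A `p`-processor contract schedule: processor `j` executes, one after the other and without
idling from time `0` on, contracts of positive, strictly increasing lengths
`len j 0 < len j 1 < ⋯`. -/
structure ContractSchedule (p : ℕ) where
  len : Fin p → ℕ → ℝ
  len_pos : ∀ j i, 0 < len j i
  len_strictMono : ∀ j, StrictMono (len j)

namespace ContractSchedule

variable {p : ℕ}

/-- The time at which contract `i` of processor `j` completes. -/
def finishTime (X : ContractSchedule p) (j : Fin p) (i : ℕ) : ℝ :=
  ∑ k ∈ Finset.range (i + 1), X.len j k

/-- The lengths of all contracts completed by time `T` on the processors in `s`. -/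
def completedLengths (X : ContractSchedule p) (s : Set (Fin p)) (T : ℝ) : Set ℝ :=
  {L | ∃ j ∈ s, ∃ i, X.finishTime j i ≤ T ∧ L = X.len j i}

/-- The length of the longest contract completed by time `T` on the processors in `s`
(meaningful once some contract has completed on one of these processors). -/
noncomputable def longestCompleted (X : ContractSchedule p) (s : Set (Fin p)) (T : ℝ) : ℝ :=
  sSup (X.completedLengths s T)

/-- The acceleration ratio when exactly the processors in `s` function: the supremum of
`T / (longest contract completed by time T)` over all interruption times `T` by which at least
one contract has completed (on a functioning processor). -/
noncomputable def accRatioOn (X : ContractSchedule p) (s : Set (Fin p)) : EReal :=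
  ⨆ (T : ℝ) (_ : (X.completedLengths s T).Nonempty), ((T / X.longestCompleted s T : ℝ) : EReal)

/-- The acceleration ratio if up to `f` processors may be faulty: the worst case over all sets `F`
of at most `f` faulty processors, which contribute no completed contract at all. -/
noncomputable def accRatioFaulty (X : ContractSchedule p) (f : ℕ) : EReal :=
  ⨆ (F : Finset (Fin p)) (_ : F.card ≤ f), X.accRatioOn {j | j ∉ F}

/-- The acceleration ratio is at most `r` whenever all but a single processor are faulty. -/
def IsRobust (X : ContractSchedule p) (r : ℝ) : Prop :=
  ∀ j : Fin p, X.accRatioOn {j} ≤ (r : EReal)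

/-- The cyclic schedule with base `b > 1`: processor `j` executes contracts of lengths
`b ^ j, b ^ (j + p), b ^ (j + 2 p), …`. -/
def cyclic (p : ℕ) (b : ℝ) (hb : 1 < b) : ContractSchedule p where
  len j i := b ^ ((j : ℕ) + i * p)
  len_pos _ _ := pow_pos (lt_trans one_pos hb) _
  len_strictMono j := fun _ _ h =>
    pow_lt_pow_right₀ hb (Nat.add_lt_add_left (Nat.mul_lt_mul_of_pos_right h j.pos) _)

end ContractSchedule

/-- The smallest root of `x ^ 2 / (x - 1) - r`, for `r ≥ 4` (see `isLeast_zeta₁`). -/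
noncomputable def zeta₁ (r : ℝ) : ℝ := (r - √(r ^ 2 - 4 * r)) / 2

/-- The largest root of `x ^ 2 / (x - 1) - r`, for `r ≥ 4` (see `isGreatest_zeta₂`). -/
noncomputable def zeta₂ (r : ℝ) : ℝ := (r + √(r ^ 2 - 4 * r)) / 2

theorem root_iff_zeta {r : ℝ} (hr : 4 ≤ r) (x : ℝ) :
    (x ≠ 1 ∧ x ^ 2 / (x - 1) - r = 0) ↔ x = zeta₁ r ∨ x = zeta₂ r := by
  have hs : √(r ^ 2 - 4 * r) ^ 2 = r ^ 2 - 4 * r := Real.sq_sqrt (by nlinarith)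
  have key : x ^ 2 - r * x + r = (x - zeta₁ r) * (x - zeta₂ r) := by
    unfold zeta₁ zeta₂
    linear_combination (1 / 4) * hs
  have h1 : (x ≠ 1 ∧ x ^ 2 / (x - 1) - r = 0) ↔ x ^ 2 - r * x + r = 0 := by
    constructor
    · rintro ⟨hx, h⟩
      have hx' : x - 1 ≠ 0 := sub_ne_zero.mpr hx
      field_simp at h
      linarith
    · intro h
      have hx : x ≠ 1 := by
        rintro rfl
        norm_num at h
      refine ⟨hx, ?_⟩
      have hx' : x - 1 ≠ 0 := sub_ne_zero.mpr hx
      field_simp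
      linarith
  rw [h1, key, mul_eq_zero, sub_eq_zero, sub_eq_zero]

theorem zeta₁_le_zeta₂ (r : ℝ) : zeta₁ r ≤ zeta₂ r := by
  unfold zeta₁ zeta₂
  linarith [Real.sqrt_nonneg (r ^ 2 - 4 * r)]

theorem isLeast_zeta₁ {r : ℝ} (hr : 4 ≤ r) :
    IsLeast {x : ℝ | x ≠ 1 ∧ x ^ 2 / (x - 1) - r = 0} (zeta₁ r) := by
  refine ⟨(root_iff_zeta hr _).2 (Or.inl rfl), fun x hx => ?_⟩
  rcases (root_iff_zeta hr x).1 hx with rfl | rfl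
  exacts [le_rfl, zeta₁_le_zeta₂ r]

theorem isGreatest_zeta₂ {r : ℝ} (hr : 4 ≤ r) :
    IsGreatest {x : ℝ | x ≠ 1 ∧ x ^ 2 / (x - 1) - r = 0} (zeta₂ r) := by
  refine ⟨(root_iff_zeta hr _).2 (Or.inr rfl), fun x hx => ?_⟩
  rcases (root_iff_zeta hr x).1 hx with rfl | rfl
  exacts [zeta₁_le_zeta₂ r, le_rfl]

/-- The feasible bases: the interval `[ζ₁ ^ (1 / p), ζ₂ ^ (1 / p)]`. -/
noncomputable def baseInterval (r : ℝ) (p : ℕ) : Set ℝ :=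
  Set.Icc (zeta₁ r ^ (1 / (p : ℝ))) (zeta₂ r ^ (1 / (p : ℝ)))

open Filter Topology MeasureTheory

/-! Lower bound: let `S i` be the completion times on one processor. Robustness forces the ratios `u
i = S (i + 1) / S i` to satisfy `u (i + 1) ≤ r - r / u i`. The fixed points of `x ↦ r - r / x` are
`zeta₁ r` and `zeta₂ r`, so every ratio is at least `zeta₁ r` and the limsup is at most `zeta₂ r`.
If the faulty ratio is at most `R`, every late time `T` lies in some `[S i, R * len i]` on at least
`f + 1` processors. On the logarithmic scale such an interval has length `log (R (1 - 1 / x))`,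
against a step `log x` between completions, where `x` is the ratio ending at `S i`. With `x = b ^
p`, having `R` below the claimed minimum means that the length is less than `(f + 1) / p` times the
step. Compactness makes the gap uniform, so `p` processors cannot cover a long interval `f + 1`
times (`IsRobust.lt_accRatioFaulty`). Upper bound: in the cyclic schedule any `f + 1` successive
exponents belong to distinct processors, and one of these is not faulty
(`cyclic_accRatioFaulty_le`). -/

theorem one_lt_zeta₁ {r : ℝ} (hr : 4 ≤ r) : 1 < zeta₁ r := by
  have h : √(r ^ 2 - 4 * r) < r - 2 := by
    rw [Real.sqrt_lt' (by linarith)]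
    nlinarith
  unfold zeta₁
  linarith

theorem sq_sub_mul_add_eq {r : ℝ} (hr : 4 ≤ r) (x : ℝ) :
    x ^ 2 - r * x + r = (x - zeta₁ r) * (x - zeta₂ r) := by
  have hs : √(r ^ 2 - 4 * r) ^ 2 = r ^ 2 - 4 * r := Real.sq_sqrt (by nlinarith)
  unfold zeta₁ zeta₂
  linear_combination (1 / 4) * hs

/-! ### Sequences of ratios with `u (n + 1) ≤ r - r / u n` -/

/-- Passing to the limit in the recursion gives `L ≤ r - r / L`, that is, `(L - zeta₁ r) * (L -
zeta₂ r) ≤ 0`. -/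
theorem exists_tendsto_mem_Icc_zeta {r : ℝ} (hr : 4 ≤ r) {u : ℕ → ℝ} (hu : Antitone u)
    (h1 : ∀ n, 1 ≤ u n) (hstep : ∀ n, u (n + 1) ≤ r - r / u n) :
    ∃ L ∈ Set.Icc (zeta₁ r) (zeta₂ r), Tendsto u atTop (𝓝 L) := by
  have hbdd : BddBelow (Set.range u) := ⟨1, by rintro _ ⟨n, rfl⟩; exact h1 n⟩
  have hL := tendsto_atTop_ciInf hu hbdd
  set L := ⨅ n, u n
  have hL1 : 1 ≤ L := ge_of_tendsto' hL h1
  have hle : L ≤ r - r / L :=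
    le_of_tendsto_of_tendsto' (hL.comp (tendsto_add_atTop_nat 1))
      (tendsto_const_nhds.sub (tendsto_const_nhds.div hL (by positivity))) hstep
  have hmul : (L - zeta₁ r) * (L - zeta₂ r) ≤ 0 := by
    rw [← sq_sub_mul_add_eq hr]
    have hLr : L * (r - r / L) = L * r - r := by field_simp
    nlinarith [mul_le_mul_of_nonneg_left hle (zero_le_one.trans hL1)]
  have hz := zeta₁_le_zeta₂ r
  refine ⟨L, ⟨?_, ?_⟩, hL⟩ <;> by_contra! h <;> nlinarith

theorem le_self_of_sub_div {r x : ℝ} (hr : 4 ≤ r) (hx : 0 < x)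
    (h : x ≤ zeta₁ r ∨ zeta₂ r ≤ x) : r - r / x ≤ x := by
  have hz := zeta₁_le_zeta₂ r
  have hmul : 0 ≤ (x - zeta₁ r) * (x - zeta₂ r) := by
    rcases h with h | h
    · exact mul_nonneg_of_nonpos_of_nonpos (by linarith) (by linarith)
    · exact mul_nonneg (by linarith) (by linarith)
  rw [← sq_sub_mul_add_eq hr] at hmul
  rw [sub_le_iff_le_add, ← sub_le_iff_le_add', le_div_iff₀ hx]
  nlinarith

/-- A term below `zeta₁ r` would make the sequence decrease from there on, to a limit below `zeta₁
r`. -/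
theorem zeta₁_le_of_step {r : ℝ} (hr : 4 ≤ r) {u : ℕ → ℝ} (h1 : ∀ n, 1 ≤ u n)
    (hstep : ∀ n, u (n + 1) ≤ r - r / u n) (n : ℕ) : zeta₁ r ≤ u n := by
  by_contra! hn
  have hlt : ∀ m, u (n + m) < zeta₁ r := by
    intro m
    induction m with
    | zero => exact hn
    | succ m ih =>
      exact ((hstep (n + m)).trans (le_self_of_sub_div hr (by linarith [h1 (n + m)])
        (Or.inl ih.le))).trans_lt ih
  have hanti : Antitone fun m => u (n + m) := antitone_nat_of_succ_le fun m =>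
    (hstep (n + m)).trans (le_self_of_sub_div hr (by linarith [h1 (n + m)]) (Or.inl (hlt m).le))
  obtain ⟨L, hLz, hL⟩ := exists_tendsto_mem_Icc_zeta hr hanti (fun m => h1 _) (fun m => hstep _)
  have : L ≤ u (n + 0) := hanti.le_of_tendsto hL 0
  exact absurd hLz.1 (not_le.2 (this.trans_lt hn))

/-- Monotonicity of `x ↦ r - r / x` keeps the sequence below `zeta₂ r` once it gets there. Otherwise
it decreases to a limit in the interval, possibly without reaching `zeta₂ r`, hence the `ε`. -/
theorem eventually_lt_zeta₂_add {r : ℝ} (hr : 4 ≤ r) {u : ℕ → ℝ} (h1 : ∀ n, 1 ≤ u n)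
    (hstep : ∀ n, u (n + 1) ≤ r - r / u n) {ε : ℝ} (hε : 0 < ε) :
    ∀ᶠ n in atTop, u n < zeta₂ r + ε := by
  have hz : 1 < zeta₂ r := (one_lt_zeta₁ hr).trans_le (zeta₁_le_zeta₂ r)
  by_cases h : ∃ k, u k ≤ zeta₂ r
  · obtain ⟨k, hk⟩ := h
    filter_upwards [eventually_ge_atTop k] with n hn
    suffices u n ≤ zeta₂ r by linarith
    induction n, hn using Nat.le_induction with
    | base => exact hk
    | succ n hn ih =>
      calc u (n + 1) ≤ r - r / u n := hstep n
        _ ≤ r - r / zeta₂ r := by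
          have := h1 n
          gcongr
        _ ≤ zeta₂ r := le_self_of_sub_div hr (by linarith) (Or.inr le_rfl)
  · push Not at h
    have hanti : Antitone u := antitone_nat_of_succ_le fun m =>
      (hstep m).trans (le_self_of_sub_div hr (by linarith [h1 m]) (Or.inr (h m).le))
    obtain ⟨L, hLz, hL⟩ := exists_tendsto_mem_Icc_zeta hr hanti h1 hstep
    exact hL.eventually_lt_const (by linarith [hLz.2])

/-- Compactness turns the pointwise strict inequality into a uniform gap; continuity at `zeta₂ r`
extends it by `ε`, since the ratios respect `zeta₂ r` only asymptotically. -/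
theorem exists_slope {r R κ : ℝ} (hr : 4 ≤ r) (hR : 0 < R) (hκ : 0 < κ)
    (h : ∀ x ∈ Set.Icc (zeta₁ r) (zeta₂ r), Real.log (R * (1 - 1 / x)) < κ * Real.log x) :
    ∃ κ', 0 ≤ κ' ∧ κ' < κ ∧ ∃ ε > 0, ∀ x, zeta₁ r ≤ x → x < zeta₂ r + ε →
      Real.log (R * (1 - 1 / x)) ≤ κ' * Real.log x := by
  have hz := one_lt_zeta₁ hr
  set ψ : ℝ → ℝ := fun x => Real.log (R * (1 - 1 / x)) / Real.log x
  have hcont : ∀ x, 1 < x → ContinuousAt ψ x := by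
    intro x hx
    have hlog : Real.log x ≠ 0 := (Real.log_pos hx).ne'
    have hx0 : x ≠ 0 := by linarith
    have hne : R * (1 - 1 / x) ≠ 0 := by
      have : 1 / x < 1 := by rw [div_lt_one (by linarith)]; exact hx
      exact mul_ne_zero hR.ne' (by linarith)
    exact ContinuousAt.div ((continuousAt_const.mul
      (continuousAt_const.sub (continuousAt_const.div continuousAt_id hx0))).log hne)
      (Real.continuousAt_log hx0) hlog
  obtain ⟨m, hm, hmax⟩ := isCompact_Icc.exists_isMaxOn
    (Set.nonempty_Icc.2 (zeta₁_le_zeta₂ r))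
    (fun x hx => (hcont x (hz.trans_le hx.1)).continuousWithinAt)
  have hmκ : ψ m < κ := by
    rw [div_lt_iff₀ (Real.log_pos (hz.trans_le hm.1))]
    exact h m hm
  obtain ⟨κ', h1, h2⟩ := exists_between (max_lt hmκ hκ)
  have hnear : ∀ᶠ x in 𝓝 (zeta₂ r), ψ x < κ' := by
    refine (hcont _ (hz.trans_le (zeta₁_le_zeta₂ r))).eventually_lt_const ?_
    exact (hmax (Set.right_mem_Icc.2 (zeta₁_le_zeta₂ r))).trans_lt ((le_max_left _ _).trans_lt h1)
  obtain ⟨ε, hε, hball⟩ := Metric.eventually_nhds_iff.1 hnear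
  refine ⟨κ', (le_max_right _ _).trans h1.le, h2, ε, hε, fun x hx hxε => ?_⟩
  rw [← div_le_iff₀ (Real.log_pos (hz.trans_le hx))]
  rcases le_or_gt x (zeta₂ r) with hle | hgt
  · exact (hmax ⟨hx, hle⟩).trans ((le_max_left _ _).trans h1.le)
  · refine (hball ?_).le
    rw [Real.dist_eq, abs_of_pos (by linarith)]
    linarith

/-! ### A covering estimate -/

/-- Double counting: integrate over `S` the number of sets `C j` containing the point. -/
theorem mul_volume_le_sum_volume {ι : Type*} [Fintype ι] {C : ι → Set ℝ} {S : Set ℝ}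
    (hC : ∀ j, MeasurableSet (C j)) (hS : MeasurableSet S) {k : ℕ}
    (h : ∀ x ∈ S, ∃ F : Finset ι, k ≤ F.card ∧ ∀ j ∈ F, x ∈ C j) :
    (k : ENNReal) * volume S ≤ ∑ j, volume (C j ∩ S) := by
  calc (k : ENNReal) * volume S = ∫⁻ _ in S, (k : ENNReal) := by simp
    _ ≤ ∫⁻ x in S, ∑ j, (C j).indicator 1 x := by
      refine setLIntegral_mono' hS fun x hx => ?_
      obtain ⟨F, hF, hFC⟩ := h x hx
      calc (k : ENNReal) ≤ (F.card : ENNReal) := by exact_mod_cast hF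
        _ = ∑ j ∈ F, (C j).indicator 1 x := by
          rw [Finset.sum_congr rfl fun j hj => Set.indicator_of_mem (hFC j hj) _]
          simp
        _ ≤ ∑ j, (C j).indicator 1 x := Finset.sum_le_univ_sum_of_nonneg fun _ => zero_le
    _ = ∑ j, volume (C j ∩ S) := by
      rw [lintegral_finsetSum _ fun j _ => measurable_one.indicator (hC j)]
      refine Finset.sum_congr rfl fun j _ => ?_
      rw [lintegral_indicator_one (hC j), Measure.restrict_apply (hC j)]

/-- The interval lengths are eventually at most `κ` times the steps of `a`, which telescope; `K`
absorbs the initial intervals. -/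
theorem exists_volume_iUnion_Icc_le {a c : ℕ → ℝ} (ha : StrictMono a) (hlim : Tendsto a atTop atTop)
    {κ : ℝ} (hκ : 0 ≤ κ) (h : ∀ᶠ i in atTop, c (i + 1) - a (i + 1) ≤ κ * (a (i + 1) - a i)) :
    ∃ K, 0 ≤ K ∧ ∀ᶠ t in atTop,
      volume ((⋃ i, Set.Icc (a i) (c i)) ∩ Set.Iic t) ≤ ENNReal.ofReal (K + κ * t) := by
  obtain ⟨m, hm⟩ := eventually_atTop.1 h
  set d : ℕ → ℝ := fun i => max 0 (c i - a i)
  set K : ℝ := ∑ i ∈ Finset.range (m + 1), d i - κ * a m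
  have hsum : ∀ n, m ≤ n → ∑ i ∈ Finset.range (n + 1), d i ≤ K + κ * a n := by
    intro n hn
    induction n, hn using Nat.le_induction with
    | base => simp [K]
    | succ n hn ih =>
      rw [Finset.sum_range_succ]
      have : d (n + 1) ≤ κ * (a (n + 1) - a n) :=
        max_le (mul_nonneg hκ (sub_nonneg.2 (ha n.lt_succ_self).le)) (hm n hn)
      linarith
  refine ⟨max K 0, le_max_right _ _, ?_⟩
  filter_upwards [eventually_ge_atTop (a m)] with t ht
  have hex : ∃ n, t < a n := (hlim.eventually_gt_atTop t).exists
  -- `n` is the last index with `a n ≤ t`; later intervals do not meet `Iic t`.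
  obtain ⟨n, hn⟩ : ∃ n, Nat.find hex = n + 1 := by
    refine Nat.exists_eq_succ_of_ne_zero fun h0 => ?_
    have := Nat.find_spec hex
    rw [h0] at this
    linarith [ha.monotone (Nat.zero_le m)]
  have htn : t < a (n + 1) := hn ▸ Nat.find_spec hex
  have hnt : a n ≤ t := not_lt.1 (Nat.find_min hex (by omega))
  have hmn : m ≤ n := Nat.lt_succ_iff.1 (ha.lt_iff_lt.1 (ht.trans_lt htn))
  calc volume ((⋃ i, Set.Icc (a i) (c i)) ∩ Set.Iic t)
      ≤ volume (⋃ i ∈ Finset.range (n + 1), Set.Icc (a i) (c i)) := by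
        refine measure_mono ?_
        rintro x ⟨hx, hxt⟩
        obtain ⟨i, hi⟩ := Set.mem_iUnion.1 hx
        refine Set.mem_biUnion (x := i) ?_ hi
        exact Finset.mem_coe.2 (Finset.mem_range.2
          (ha.lt_iff_lt.1 ((hi.1.trans hxt).trans_lt htn)))
    _ ≤ ∑ i ∈ Finset.range (n + 1), volume (Set.Icc (a i) (c i)) :=
        measure_biUnion_finset_le _ _
    _ ≤ ∑ i ∈ Finset.range (n + 1), ENNReal.ofReal (d i) := by
        refine Finset.sum_le_sum fun i _ => ?_
        rw [Real.volume_Icc]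
        exact ENNReal.ofReal_le_ofReal (le_max_right _ _)
    _ = ENNReal.ofReal (∑ i ∈ Finset.range (n + 1), d i) :=
        (ENNReal.ofReal_sum_of_nonneg fun i _ => le_max_left _ _).symm
    _ ≤ ENNReal.ofReal (max K 0 + κ * t) := by
        refine ENNReal.ofReal_le_ofReal ((hsum n hmn).trans ?_)
        gcongr
        exact le_max_left _ _

namespace ContractSchedule

variable {p : ℕ}

/-! ### Completion times and longest completed contracts -/

theorem finishTime_succ (X : ContractSchedule p) (j : Fin p) (i : ℕ) :
    X.finishTime j (i + 1) = X.finishTime j i + X.len j (i + 1) :=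
  Finset.sum_range_succ _ _

theorem finishTime_strictMono (X : ContractSchedule p) (j : Fin p) :
    StrictMono (X.finishTime j) :=
  strictMono_nat_of_lt_succ fun i => by
    rw [finishTime_succ]
    linarith [X.len_pos j (i + 1)]

theorem finishTime_pos (X : ContractSchedule p) (j : Fin p) (i : ℕ) : 0 < X.finishTime j i :=
  Finset.sum_pos (fun k _ => X.len_pos j k) ⟨0, by simp⟩

theorem tendsto_finishTime (X : ContractSchedule p) (j : Fin p) :
    Tendsto (X.finishTime j) atTop atTop := by
  refine tendsto_atTop_mono (f := fun i : ℕ => (i : ℝ) * X.len j 0) (fun i => ?_)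
    (tendsto_natCast_atTop_atTop.atTop_mul_const (X.len_pos j 0))
  have h := Finset.card_nsmul_le_sum (Finset.range (i + 1)) (X.len j) (X.len j 0)
    fun k _ => (X.len_strictMono j).monotone (Nat.zero_le k)
  rw [Finset.card_range, nsmul_eq_mul, Nat.cast_succ] at h
  have := X.len_pos j 0
  unfold finishTime
  linarith

theorem finite_completedLengths (X : ContractSchedule p) (s : Set (Fin p)) (T : ℝ) :
    (X.completedLengths s T).Finite := by
  have hfin : ∀ j, {i | X.finishTime j i ≤ T}.Finite := fun j => by
    obtain ⟨N, hN⟩ := ((X.tendsto_finishTime j).eventually_gt_atTop T).exists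
    exact (Set.finite_lt_nat N).subset fun i hi =>
      (X.finishTime_strictMono j).lt_iff_lt.1 (lt_of_le_of_lt hi hN)
  refine (Set.finite_iUnion fun j => (hfin j).image (X.len j)).subset ?_
  rintro _ ⟨j, -, i, hi, rfl⟩
  exact Set.mem_iUnion.2 ⟨j, i, hi, rfl⟩

theorem exists_longestCompleted_eq {X : ContractSchedule p} {s : Set (Fin p)} {T : ℝ}
    (h : (X.completedLengths s T).Nonempty) :
    ∃ j ∈ s, ∃ i, X.finishTime j i ≤ T ∧ X.longestCompleted s T = X.len j i :=
  h.csSup_mem (X.finite_completedLengths s T)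

theorem len_le_longestCompleted (X : ContractSchedule p) {s : Set (Fin p)} {T : ℝ} {j : Fin p}
    (hj : j ∈ s) {i : ℕ} (hi : X.finishTime j i ≤ T) : X.len j i ≤ X.longestCompleted s T :=
  le_csSup (X.finite_completedLengths s T).bddAbove ⟨j, hj, i, hi, rfl⟩

theorem accRatioOn_le_iff (X : ContractSchedule p) (s : Set (Fin p)) (R : ℝ) :
    X.accRatioOn s ≤ (R : EReal) ↔
      ∀ T, (X.completedLengths s T).Nonempty → T ≤ R * X.longestCompleted s T := by
  unfold accRatioOn
  rw [iSup₂_le_iff]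
  refine forall₂_congr fun T h => ?_
  obtain ⟨j, -, i, -, hl⟩ := exists_longestCompleted_eq h
  rw [EReal.coe_le_coe_iff, div_le_iff₀ (hl ▸ X.len_pos j i)]

theorem IsRobust.finishTime_succ_le {X : ContractSchedule p} {r : ℝ} (hX : X.IsRobust r)
    (hr : 0 ≤ r) (j : Fin p) (i : ℕ) : X.finishTime j (i + 1) ≤ r * X.len j i := by
  -- Interrupt just before contract `i + 1` completes: the longest completed contract is then `i`.
  refine le_of_forall_lt_imp_le_of_dense fun T₀ hT₀ => ?_
  set T := max (X.finishTime j i) T₀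
  have hT : T < X.finishTime j (i + 1) := max_lt (X.finishTime_strictMono j i.lt_succ_self) hT₀
  have hne : (X.completedLengths {j} T).Nonempty := ⟨_, j, rfl, i, le_max_left _ _, rfl⟩
  obtain ⟨j', rfl, i', hi', hl⟩ := exists_longestCompleted_eq hne
  have hle : i' ≤ i := Nat.lt_succ_iff.1
    ((X.finishTime_strictMono _).lt_iff_lt.1 (hi'.trans_lt hT))
  calc T₀ ≤ T := le_max_right _ _
    _ ≤ r * X.longestCompleted {j'} T := (accRatioOn_le_iff X _ r).1 (hX _) T hne
    _ ≤ r * X.len j' i := by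
      rw [hl]
      exact mul_le_mul_of_nonneg_left ((X.len_strictMono _).monotone hle) hr

/-! ### The cyclic schedule -/

theorem cyclic_finishTime_lt {b : ℝ} (hb : 1 < b) (j : Fin p) (i : ℕ) :
    (cyclic p b hb).finishTime j i < b ^ ((j : ℕ) + i * p + p) / (b ^ p - 1) := by
  have hp : 1 < b ^ p := one_lt_pow₀ hb j.pos.ne'
  have hsum : (cyclic p b hb).finishTime j i = b ^ (j : ℕ) * ((b ^ p) ^ (i + 1) - 1) / (b ^ p - 1) := by
    unfold finishTime
    rw [mul_div_assoc, ← geom_sum_eq hp.ne', Finset.mul_sum]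
    refine Finset.sum_congr rfl fun k _ => ?_
    simp only [cyclic]
    rw [← pow_mul, ← pow_add, mul_comm k]
  rw [hsum]
  refine div_lt_div_of_pos_right ?_ (by linarith)
  have hexp : b ^ ((j : ℕ) + i * p + p) = b ^ (j : ℕ) * (b ^ p) ^ (i + 1) := by
    rw [← pow_mul, ← pow_add]
    congr 1
    ring
  rw [hexp]
  have : 0 < b ^ (j : ℕ) := by positivity
  linarith

/-- If among the `g` contracts following any contract of a processor in `s` there is another one
of a processor in `s`, then the acceleration ratio is at most `b ^ (p + g) / (b ^ p - 1)`. -/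
theorem cyclic_accRatioOn_le {b : ℝ} (hb : 1 < b) {s : Set (Fin p)} {g : ℕ}
    (hg : ∀ j ∈ s, ∀ i : ℕ, ∃ j' ∈ s, ∃ i' : ℕ, (j : ℕ) + i * p < (j' : ℕ) + i' * p ∧
      (j' : ℕ) + i' * p ≤ (j : ℕ) + i * p + g) :
    (cyclic p b hb).accRatioOn s ≤ ((b ^ (p + g) / (b ^ p - 1) : ℝ) : EReal) := by
  rw [accRatioOn_le_iff]
  intro T hT
  obtain ⟨j, hj, i, -, hl⟩ := exists_longestCompleted_eq hT
  have hp : 1 < b ^ p := one_lt_pow₀ hb j.pos.ne'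
  obtain ⟨j', hj', i', hlt, hle⟩ := hg j hj i
  -- Otherwise the longer contract `i'` of `j'` would already be completed.
  have hT' : T < (cyclic p b hb).finishTime j' i' := by
    by_contra! h
    have := len_le_longestCompleted _ hj' h
    rw [hl] at this
    exact absurd (pow_lt_pow_right₀ hb hlt) (not_lt.2 this)
  calc T ≤ b ^ ((j' : ℕ) + i' * p + p) / (b ^ p - 1) :=
        (hT'.trans (cyclic_finishTime_lt hb j' i')).le
    _ ≤ b ^ ((j : ℕ) + i * p + g + p) / (b ^ p - 1) := by
        refine div_le_div_of_nonneg_right (pow_le_pow_right₀ hb.le (by omega)) (by linarith)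
    _ = b ^ (p + g) / (b ^ p - 1) * (cyclic p b hb).longestCompleted s T := by
        rw [hl, div_mul_eq_mul_div]
        simp only [cyclic]
        rw [← pow_add]
        congr 2
        ring

theorem cyclic_isRobust {r b : ℝ} (hb : 1 < b) (h : b ^ (p + p) / (b ^ p - 1) ≤ r) :
    (cyclic p b hb).IsRobust r := by
  intro j
  refine (cyclic_accRatioOn_le hb (g := p) ?_).trans (EReal.coe_le_coe_iff.2 h)
  rintro _ rfl i
  have := Fin.pos ‹_›
  exact ⟨_, rfl, i + 1, by rw [add_mul]; omega, by rw [add_mul]; omega⟩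

theorem cyclic_accRatioFaulty_le {b : ℝ} (hb : 1 < b) {f : ℕ} (hf : f < p) :
    (cyclic p b hb).accRatioFaulty f ≤ ((b ^ (p + f + 1) / (b ^ p - 1) : ℝ) : EReal) := by
  have hp : 0 < p := by omega
  refine iSup₂_le fun F hF => cyclic_accRatioOn_le hb (g := f + 1) fun j _ i => ?_
  set n := (j : ℕ) + i * p
  -- The processors running exponents `n + 1, …, n + f + 1`, distinct because `f < p`.
  let e : Fin (f + 1) → Fin p := fun q => ⟨(n + 1 + q) % p, Nat.mod_lt _ hp⟩
  have he : Function.Injective e := by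
    intro q q' h
    have h' : n + 1 + q ≡ n + 1 + q' [MOD p] := congrArg Fin.val h
    exact Fin.ext ((Nat.ModEq.add_left_cancel' _ h').eq_of_lt_of_lt (by omega) (by omega))
  obtain ⟨x, hx, hxF⟩ : ∃ x ∈ Finset.univ.map ⟨e, he⟩, x ∉ F :=
    Finset.exists_mem_notMem_of_card_lt_card (by
      rw [Finset.card_map, Finset.card_univ, Fintype.card_fin]
      omega)
  obtain ⟨q, -, rfl⟩ := Finset.mem_map.1 hx
  refine ⟨e q, hxF, (n + 1 + q) / p, ?_⟩
  have : (e q : ℕ) + (n + 1 + q) / p * p = n + 1 + q := Nat.mod_add_div' _ _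
  rw [this]
  omega

/-! ### The lower bound -/

/-- If at most `f` processors had a long enough completed contract, exactly these could be declared
faulty, and the remaining ones would violate the ratio `R`. -/
theorem exists_covering_processors {X : ContractSchedule p} {f : ℕ} (hf : f < p) {R : ℝ}
    (hX : X.accRatioFaulty f ≤ (R : EReal)) {T : ℝ} (hT : ∀ j, X.finishTime j 0 ≤ T) :
    ∃ F : Finset (Fin p), f + 1 ≤ F.card ∧
      ∀ j ∈ F, ∃ i, X.finishTime j i ≤ T ∧ T ≤ R * X.len j i := by
  classical
  set F : Finset (Fin p) :=
    Finset.univ.filter fun j => ∃ i, X.finishTime j i ≤ T ∧ T ≤ R * X.len j i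
  refine ⟨F, ?_, fun j hj => (Finset.mem_filter.1 hj).2⟩
  by_contra! hF
  obtain ⟨j₀, -, hj₀⟩ : ∃ j ∈ Finset.univ, j ∉ F :=
    Finset.exists_mem_notMem_of_card_lt_card (by
      rw [Finset.card_univ, Fintype.card_fin]
      omega)
  have hne : (X.completedLengths {j | j ∉ F} T).Nonempty := ⟨_, j₀, hj₀, 0, hT j₀, rfl⟩
  have hacc : X.accRatioOn {j | j ∉ F} ≤ (R : EReal) :=
    (le_iSup₂ (f := fun (F : Finset (Fin p)) (_ : F.card ≤ f) => X.accRatioOn {j | j ∉ F})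
      F (by omega)).trans hX
  have hle := (accRatioOn_le_iff X _ R).1 hacc T hne
  obtain ⟨j, hj, i, hi, hl⟩ := exists_longestCompleted_eq hne
  exact hj (Finset.mem_filter.2 ⟨Finset.mem_univ j, i, hi, hl ▸ hle⟩)

/-- A length is a difference of successive completion times, so `IsRobust.finishTime_succ_le`
divided by a completion time is the ratio recursion. -/
theorem IsRobust.ratio_bounds {X : ContractSchedule p} {r : ℝ} (hX : X.IsRobust r) (hr : 4 ≤ r)
    (j : Fin p) :
    (∀ i, zeta₁ r ≤ X.finishTime j (i + 1) / X.finishTime j i) ∧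
    ∀ ε > 0, ∀ᶠ i in atTop, X.finishTime j (i + 1) / X.finishTime j i < zeta₂ r + ε := by
  have h1 : ∀ i, 1 ≤ X.finishTime j (i + 1) / X.finishTime j i := fun i => by
    rw [one_le_div (X.finishTime_pos j i)]
    exact (X.finishTime_strictMono j i.lt_succ_self).le
  have hstep : ∀ i, X.finishTime j (i + 1 + 1) / X.finishTime j (i + 1) ≤
      r - r / (X.finishTime j (i + 1) / X.finishTime j i) := fun i => by
    have hs := X.finishTime_pos j (i + 1)
    rw [div_le_iff₀ hs]
    have h := hX.finishTime_succ_le (by linarith) j (i + 1)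
    have hlen := X.finishTime_succ j i
    calc X.finishTime j (i + 1 + 1) ≤ r * X.len j (i + 1) := h
      _ = r * X.finishTime j (i + 1) - r * X.finishTime j i := by rw [hlen]; ring
      _ = _ := by field_simp
  exact ⟨zeta₁_le_of_step hr h1 hstep, fun ε hε => eventually_lt_zeta₂_add hr h1 hstep hε⟩

theorem IsRobust.exists_volume_covered_le {X : ContractSchedule p} {r R κ ε : ℝ}
    (hX : X.IsRobust r) (hr : 4 ≤ r) (hR : 0 < R) (hκ : 0 ≤ κ) (hε : 0 < ε)
    (h : ∀ x, zeta₁ r ≤ x → x < zeta₂ r + ε → Real.log (R * (1 - 1 / x)) ≤ κ * Real.log x)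
    (j : Fin p) :
    ∃ K, 0 ≤ K ∧ ∀ᶠ t in atTop,
      volume ((⋃ i, Set.Icc (Real.log (X.finishTime j i)) (Real.log (R * X.len j i))) ∩ Set.Iic t)
        ≤ ENNReal.ofReal (K + κ * t) := by
  obtain ⟨hlow, hupp⟩ := hX.ratio_bounds hr j
  refine exists_volume_iUnion_Icc_le
    (fun i i' hi => Real.log_lt_log (X.finishTime_pos j i) (X.finishTime_strictMono j hi))
    (Real.tendsto_log_atTop.comp (X.tendsto_finishTime j)) hκ ?_
  filter_upwards [hupp ε hε] with i hi
  have hs := X.finishTime_pos j i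
  have hs' := X.finishTime_pos j (i + 1)
  have hl := X.len_pos j (i + 1)
  have hlen := X.finishTime_succ j i
  have hx := h _ (hlow i) hi
  rw [Real.log_div hs'.ne' hs.ne'] at hx
  -- The interval length is `log (R * len (i + 1) / S (i + 1)) = log (R * (1 - S i / S (i + 1)))`.
  rw [← Real.log_div (by positivity) hs'.ne']
  convert hx using 2
  rw [one_div_div, one_sub_div hs'.ne', mul_div_assoc]
  congr 2
  linarith

theorem IsRobust.lt_accRatioFaulty {X : ContractSchedule p} {r R : ℝ} {f : ℕ} (hf : f < p)
    (hX : X.IsRobust r) (hr : 4 ≤ r) (hR : 0 < R)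
    (h : ∀ x ∈ Set.Icc (zeta₁ r) (zeta₂ r),
      Real.log (R * (1 - 1 / x)) < ((f + 1 : ℕ) / p : ℝ) * Real.log x) :
    (R : EReal) < X.accRatioFaulty f := by
  by_contra! hacc
  have hp : (0 : ℝ) < p := by exact_mod_cast (by omega : 0 < p)
  obtain ⟨κ, hκ0, hκ, ε, hε, hslope⟩ := exists_slope hr hR (by positivity) h
  rw [lt_div_iff₀ hp] at hκ
  choose K hK0 hK using hX.exists_volume_covered_le hr hR hκ0 hε hslope
  set C : Fin p → Set ℝ := fun j =>
    ⋃ i, Set.Icc (Real.log (X.finishTime j i)) (Real.log (R * X.len j i))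
  obtain ⟨A, hA⟩ : ∃ A : ℝ, ∀ j, Real.log (X.finishTime j 0) ≤ A := by
    obtain ⟨A, hA⟩ := (Set.finite_range fun j => Real.log (X.finishTime j 0)).bddAbove
    exact ⟨A, fun j => hA ⟨j, rfl⟩⟩
  have hcov : ∀ t ∈ Set.Ici A, ∃ F : Finset (Fin p), f + 1 ≤ F.card ∧ ∀ j ∈ F, t ∈ C j := by
    intro t ht
    obtain ⟨F, hF, hFC⟩ := exists_covering_processors hf hacc (T := Real.exp t) fun j =>
      (Real.log_le_iff_le_exp (X.finishTime_pos j 0)).1 ((hA j).trans ht)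
    refine ⟨F, hF, fun j hj => ?_⟩
    obtain ⟨i, h1, h2⟩ := hFC j hj
    exact Set.mem_iUnion.2 ⟨i, (Real.log_le_iff_le_exp (X.finishTime_pos j i)).2 h1,
      (Real.le_log_iff_exp_le (mul_pos hR (X.len_pos j i))).2 h2⟩
  have hmeas : ∀ j, MeasurableSet (C j) := fun j => MeasurableSet.iUnion fun i => measurableSet_Icc
  have hlim : Tendsto (fun t : ℝ => ((f + 1 : ℕ) - κ * p) * t) atTop atTop :=
    tendsto_id.const_mul_atTop (by linarith)
  -- As `κ * p < f + 1`, for large `t` the demand `(f + 1) * (t - A)` exceeds the total supply `∑ j,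
  -- (K j + κ * t)`.
  obtain ⟨t, ht, ht0, htA, htK⟩ := ((eventually_all.2 hK).and ((eventually_ge_atTop 0).and
    ((eventually_ge_atTop A).and
      (hlim.eventually_gt_atTop (∑ j, K j + (f + 1 : ℕ) * A))))).exists
  have hbound : ENNReal.ofReal ((f + 1 : ℕ) * (t - A)) ≤
      ENNReal.ofReal (∑ j, (K j + κ * t)) := by
    calc ENNReal.ofReal ((f + 1 : ℕ) * (t - A))
        = ((f + 1 : ℕ) : ENNReal) * volume (Set.Icc A t) := by
          rw [ENNReal.ofReal_mul (by positivity), ENNReal.ofReal_natCast, Real.volume_Icc]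
      _ ≤ ∑ j, volume (C j ∩ Set.Icc A t) :=
          mul_volume_le_sum_volume hmeas measurableSet_Icc fun x hx => hcov x hx.1
      _ ≤ ∑ j, ENNReal.ofReal (K j + κ * t) := Finset.sum_le_sum fun j _ =>
          (measure_mono (Set.inter_subset_inter_right _ Set.Icc_subset_Iic_self)).trans (ht j)
      _ = ENNReal.ofReal (∑ j, (K j + κ * t)) :=
          (ENNReal.ofReal_sum_of_nonneg fun j _ => add_nonneg (hK0 j) (mul_nonneg hκ0 ht0)).symm
  rw [ENNReal.ofReal_le_ofReal_iff (Finset.sum_nonneg fun j _ =>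
    add_nonneg (hK0 j) (mul_nonneg hκ0 ht0)), Finset.sum_add_distrib, Finset.sum_const,
    Finset.card_univ, Fintype.card_fin, nsmul_eq_mul] at hbound
  linarith

end ContractSchedule

/-! ### The feasible bases -/

theorem pow_mem_Icc_of_mem_baseInterval {r : ℝ} (hr : 4 ≤ r) {p : ℕ} (hp : p ≠ 0) {b : ℝ}
    (hb : b ∈ baseInterval r p) : 1 < b ∧ b ^ p ∈ Set.Icc (zeta₁ r) (zeta₂ r) := by
  have hz := one_lt_zeta₁ hr
  have hz' := zeta₁_le_zeta₂ r
  have h1 : 1 < b := (Real.one_lt_rpow hz (by positivity)).trans_le hb.1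
  have hroot : ∀ z : ℝ, 0 ≤ z → (z ^ (1 / (p : ℝ))) ^ p = z := fun z hz0 => by
    rw [one_div, Real.rpow_inv_natCast_pow hz0 hp]
  refine ⟨h1, ?_, ?_⟩
  · rw [← hroot (zeta₁ r) (by linarith)]
    exact pow_le_pow_left₀ (Real.rpow_nonneg (by linarith) _) hb.1 p
  · rw [← hroot (zeta₂ r) (by linarith)]
    exact pow_le_pow_left₀ (by linarith) hb.2 p

theorem rpow_mem_baseInterval {r : ℝ} (hr : 4 ≤ r) {p : ℕ} {x : ℝ}
    (hx : x ∈ Set.Icc (zeta₁ r) (zeta₂ r)) : x ^ (1 / (p : ℝ)) ∈ baseInterval r p := by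
  have hz := one_lt_zeta₁ hr
  exact ⟨Real.rpow_le_rpow (by linarith) hx.1 (by positivity),
    Real.rpow_le_rpow (by linarith [hx.1]) hx.2 (by positivity)⟩

/-- Substitute `b = x ^ (1 / p)`, so that `b ^ p = x`, and take logarithms. -/
theorem log_lt_of_forall_baseInterval {r R : ℝ} (hr : 4 ≤ r) (hR : 0 < R) {p f : ℕ} (hp : p ≠ 0)
    (h : ∀ b ∈ baseInterval r p, R < b ^ (p + f + 1) / (b ^ p - 1)) {x : ℝ}
    (hx : x ∈ Set.Icc (zeta₁ r) (zeta₂ r)) :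
    Real.log (R * (1 - 1 / x)) < ((f + 1 : ℕ) / p : ℝ) * Real.log x := by
  have hx1 : 1 < x := (one_lt_zeta₁ hr).trans_le hx.1
  have hlt := h _ (rpow_mem_baseInterval hr hx)
  have hroot : (x ^ (1 / (p : ℝ))) ^ p = x := by
    rw [one_div, Real.rpow_inv_natCast_pow (by linarith) hp]
  rw [add_assoc, pow_add, hroot, lt_div_iff₀ (by linarith)] at hlt
  have hlt' : R * (1 - 1 / x) < (x ^ (1 / (p : ℝ))) ^ (f + 1) := by
    have hsub : R * (1 - 1 / x) = R * (x - 1) / x := by field_simp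
    rw [hsub, div_lt_iff₀ (by linarith)]
    linarith
  have hpos : 0 < R * (1 - 1 / x) := by
    have : 1 / x < 1 := by rw [div_lt_one (by linarith)]; exact hx1
    exact mul_pos hR (by linarith)
  have hlog := Real.log_lt_log hpos hlt'
  rw [Real.log_pow, Real.log_rpow (by linarith)] at hlog
  convert hlog using 1
  ring

theorem exists_isLeast_image_baseInterval {r : ℝ} (hr : 4 ≤ r) {p : ℕ} (hp : p ≠ 0) (f : ℕ) :
    ∃ v, IsLeast ((fun b : ℝ => b ^ (p + f + 1) / (b ^ p - 1)) '' baseInterval r p) v := by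
  have hcont : ContinuousOn (fun b : ℝ => b ^ (p + f + 1) / (b ^ p - 1)) (baseInterval r p) := by
    refine ContinuousOn.div (by fun_prop) (by fun_prop) fun b hb => ?_
    have := (pow_mem_Icc_of_mem_baseInterval hr hp hb).2.1
    linarith [one_lt_zeta₁ hr]
  exact (isCompact_Icc.image_of_continuousOn hcont).exists_isLeast
    (Set.Nonempty.image _ ⟨_, rpow_mem_baseInterval hr ⟨le_rfl, zeta₁_le_zeta₂ r⟩⟩)

theorem pow_add_self_div_le {r : ℝ} (hr : 4 ≤ r) {p : ℕ} (hp : p ≠ 0) {b : ℝ}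
    (hb : b ∈ baseInterval r p) : b ^ (p + p) / (b ^ p - 1) ≤ r := by
  obtain ⟨-, h1, h2⟩ := pow_mem_Icc_of_mem_baseInterval hr hp hb
  have := one_lt_zeta₁ hr
  have hmul := mul_nonpos_of_nonneg_of_nonpos (sub_nonneg.2 h1) (sub_nonpos.2 h2)
  rw [← sq_sub_mul_add_eq hr] at hmul
  rw [div_le_iff₀ (by linarith), pow_add]
  linarith

theorem mainTheorem4 (r : ℝ) (hr : 4 ≤ r) (p f : ℕ) (hf : f < p) :
    ∃ v : ℝ,
      IsLeast ((fun b : ℝ => b ^ (p + f + 1) / (b ^ p - 1)) '' baseInterval r p) v ∧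
      IsLeast {a : EReal | ∃ X : ContractSchedule p, X.IsRobust r ∧ a = X.accRatioFaulty f}
        (v : EReal) ∧
      ∀ b ∈ baseInterval r p, b ^ (p + f + 1) / (b ^ p - 1) = v →
        ∃ hb : 1 < b,
          (ContractSchedule.cyclic p b hb).IsRobust r ∧
          (ContractSchedule.cyclic p b hb).accRatioFaulty f = (v : EReal) := by
  have hp : p ≠ 0 := by omega
  obtain ⟨v, hv⟩ := exists_isLeast_image_baseInterval hr hp f
  have hlower : ∀ X : ContractSchedule p, X.IsRobust r → (v : EReal) ≤ X.accRatioFaulty f := by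
    intro X hX
    by_contra! hlt
    have hv0 : 0 < v := by
      obtain ⟨b, hb, rfl⟩ := hv.1
      obtain ⟨hb1, hb2, -⟩ := pow_mem_Icc_of_mem_baseInterval hr hp hb
      have := one_lt_zeta₁ hr
      exact div_pos (by positivity) (by linarith)
    -- The maximum with `0` makes `R` positive, as the logarithmic argument requires.
    obtain ⟨R, hR1, hR2⟩ := EReal.lt_iff_exists_real_btwn.1
      (max_lt hlt (EReal.coe_lt_coe_iff.2 hv0))
    have hR0 : 0 < R := EReal.coe_lt_coe_iff.1 ((le_max_right _ _).trans_lt hR1)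
    refine (hX.lt_accRatioFaulty hf hr hR0 fun x hx =>
      log_lt_of_forall_baseInterval hr hR0 hp (fun b hb => ?_) hx).not_ge
        ((le_max_left _ _).trans hR1.le)
    exact (EReal.coe_lt_coe_iff.1 hR2).trans_le (hv.2 ⟨b, hb, rfl⟩)
  have hcyclic : ∀ b ∈ baseInterval r p, b ^ (p + f + 1) / (b ^ p - 1) = v →
      ∃ hb : 1 < b, (ContractSchedule.cyclic p b hb).IsRobust r ∧
        (ContractSchedule.cyclic p b hb).accRatioFaulty f = (v : EReal) := by
    rintro b hb rfl
    have hb1 := (pow_mem_Icc_of_mem_baseInterval hr hp hb).1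
    have hrob := ContractSchedule.cyclic_isRobust hb1 (pow_add_self_div_le hr hp hb)
    exact ⟨hb1, hrob, le_antisymm (ContractSchedule.cyclic_accRatioFaulty_le hb1 hf)
      (hlower _ hrob)⟩
  refine ⟨v, hv, ⟨?_, ?_⟩, hcyclic⟩
  · obtain ⟨b, hb, hbv⟩ := hv.1
    obtain ⟨hb1, hrob, hacc⟩ := hcyclic b hb hbv
    exact ⟨_, hrob, hacc.symm⟩
  · rintro _ ⟨X, hX, rfl⟩
    exact hlower X hX
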